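/- All digraphs are finite and non-empty and have no parallel arcs. The minimum out-degree $\delta^+(D)$ is the least number of out-neighbours of a vertex of $D$, and the girth of $D$ is the length of a shortest directed cycle of $D$ ($+\infty$ if $D$ is acyclic). For positive integers $k,\ell$, let $C(k,\ell)$ be the union of two internally vertex-disjoint directed paths of lengths $k$ and $\ell$ with the same initial vertex and the same terminal vertex (distinct from the initial one); in particular $C(1,1)$ consists of two parallel arcs. A subdivision of $F$ is obtained by replacing the arcs of $F$ by directed paths of length at least $1$ from their tails to their heads that are pairwise internally vertex-disjoint; a digraph contains such a subdivision if it has it as a subdigraph (so parallel arcs of $F$ are replaced by distinct paths). For an integer $g$, let $\mathrm{mader}^{(g)}_{\delta^+}(F)$ be the least integer $d$ such that every digraph $D$ with $\delta^+(D)\ge d$ and girth at least $g$ contains a subdivision of $F$. **Theorem.** For every positive integer $k$, $\mathrm{mader}^{(4k+2)}_{\delta^+}(C(k,k))=2$. That is, every digraph with minimum out-degree at least $2$ and girth at least $4k+2$ contains a subdivision of $C(k,k)$, and $2$ is the least integer with this property. -/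

import Mathlib

universe u

/-- A digraph without loops in which parallel arcs are allowed: `V` is the vertex type, `A` the
arc type. Such objects are used as the patterns that get subdivided (`C(1,1)` consists of two
parallel arcs). -/
structure MultiDigraph (V A : Type*) where
  tail : A → V
  head : A → V
  loopless : ∀ a, tail a ≠ head a

/-- `l` is the vertex sequence of a directed `(x, y)`-path of `D`. Its length is
`l.length - 1`. -/
def IsDiPath {V : Type*} (D : Digraph V) (x y : V) (l : List V) : Prop :=
  l.Nodup ∧ l.IsChain D.Adj ∧ l.head? = some x ∧ l.getLast? = some y

/-- The internal vertices of a path given by its vertex sequence. -/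
def pathInterior {V : Type*} (l : List V) : List V :=
  l.tail.dropLast

/-- `D` contains a subdivision of `F` as a subdigraph: the vertices of `F` are mapped to distinct
vertices of `D`, and the arcs of `F` are replaced by distinct directed paths of `D`, each from the
image of the tail to the image of the head, such that no internal vertex of one of these paths is
the image of a vertex of `F` or an internal vertex of another one of the paths. -/
def ContainsSubdivision {V A W : Type*} (F : MultiDigraph V A) (D : Digraph W) : Prop :=
  ∃ (φ : V → W) (P : A → List W),
    Function.Injective φ ∧
    Function.Injective P ∧
    (∀ a, IsDiPath D (φ (F.tail a)) (φ (F.head a)) (P a)) ∧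
    (∀ a, ∀ x ∈ pathInterior (P a), x ∉ Set.range φ) ∧
    (∀ a b, a ≠ b → List.Disjoint (pathInterior (P a)) (pathInterior (P b)))

/-- The cyclic successor on `Fin n`. -/
def cyclicSucc {n : ℕ} (i : Fin n) : Fin n :=
  ⟨(i.val + 1) % n, Nat.mod_lt _ (Nat.lt_of_le_of_lt (Nat.zero_le _) i.isLt)⟩

theorem ne_cyclicSucc {n : ℕ} (hn : 2 ≤ n) (i : Fin n) : i ≠ cyclicSucc i := by
  intro h
  have h1 : i.val = (i.val + 1) % n := congrArg Fin.val h
  have h2 := i.isLt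
  rcases Nat.lt_or_ge (i.val + 1) n with h3 | h3
  · rw [Nat.mod_eq_of_lt h3] at h1
    omega
  · have h4 : i.val + 1 = n := by omega
    rw [h4, Nat.mod_self] at h1
    omega

/-- The cycle with two blocks `C(k, ℓ)`: the union of the two internally disjoint directed paths
`0 → 1 → ⋯ → k` of length `k` and `0 → k + ℓ - 1 → k + ℓ - 2 → ⋯ → k` of length `ℓ`. The arc with
index `i` joins `i` and `i + 1` modulo `k + ℓ`; it is directed towards `i + 1` if `i < k`, and
towards `i` otherwise. -/
def twoBlockCycle (k ℓ : ℕ) (hk : 1 ≤ k) (hℓ : 1 ≤ ℓ) :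
    MultiDigraph (Fin (k + ℓ)) (Fin (k + ℓ)) where
  tail i := if i.val < k then i else cyclicSucc i
  head i := if i.val < k then cyclicSucc i else i
  loopless i := by
    have h := ne_cyclicSucc (show 2 ≤ k + ℓ by omega) i
    split_ifs
    · exact h
    · exact h.symm

/-- The minimum out-degree of a digraph. -/
noncomputable def minOutDegree {V : Type*} (D : Digraph V) : ℕ∞ :=
  ⨅ v : V, Set.encard {w : V | D.Adj v w}

/-- `c` lists the vertices of a directed cycle of `D` in cyclic order. The length of the cycle is
`c.length`; a loop is a cycle of length `1`, and two opposite arcs form a cycle of length `2`. -/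
def IsDiCycle {V : Type*} (D : Digraph V) (c : List V) : Prop :=
  ∃ hc : c ≠ [], c.Nodup ∧ c.IsChain D.Adj ∧ D.Adj (c.getLast hc) (c.head hc)

/-- The length of a shortest directed cycle, and `⊤` for an acyclic digraph. -/
noncomputable def digirth {V : Type*} (D : Digraph V) : ℕ∞ :=
  ⨅ c ∈ {c : List V | IsDiCycle D c}, (c.length : ℕ∞)

/-- `m` is the Mader number of `F` for the minimum out-degree in digraphs of girth at least `g`:
the least `m` such that every (finite, non-empty) digraph with minimum out-degree at least `m` and
girth at least `g` contains a subdivision of `F`. -/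
def IsGirthMaderNumber {V A : Type*} (g : ℕ) (F : MultiDigraph V A) (m : ℕ) : Prop :=
  IsLeast {d : ℕ | ∀ (W : Type u) [Finite W] [Nonempty W] (D : Digraph W),
    (d : ℕ∞) ≤ minOutDegree D → (g : ℕ∞) ≤ digirth D → ContainsSubdivision F D} m

/-! Upper bound: a finite loopless digraph of minimum out-degree at least 2 has an arc yx and two
internally disjoint paths from x to y (`exists_adj_and_internally_disjoint_paths`). The arc closes
each path into a directed cycle, so girth at least k + 2 makes both paths longer than k, and they
form a subdivision of C(k,k). The bound 4k + 2 is more than is needed.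

To find the arc, take a minimal non-empty out-closed set T, then a minimal non-empty X in T whose
arcs leave X only towards one vertex z of T outside X. By minimality X is strongly connected, and no
single vertex of X cuts another one off from z. Let R be a path from z that first meets X in r, and
x ≠ z an out-neighbour of r. A fan from x to r and z, grown backwards from r by `HasFan.of_adj`,
gives two paths to r once its z-branch is extended by R.

Lower bound: a directed cycle of length 4k + 2 has out-degree 1, so no vertex can start two
internally disjoint paths. -/

section Paths

variable {V : Type*} {D : Digraph V}

/-! ### Cutting and joining directed paths -/

theorem IsDiPath.singleton (x : V) : IsDiPath D x x [x] := by
  simp [IsDiPath]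

theorem IsDiPath.end_mem {x y : V} {l : List V} (h : IsDiPath D x y l) : y ∈ l :=
  List.mem_of_getLast? h.2.2.2

theorem IsDiPath.exists_eq_cons {x y : V} {l : List V} (h : IsDiPath D x y l) :
    ∃ t, l = x :: t := by
  obtain ⟨-, -, h3, -⟩ := h
  cases l with
  | nil => simp at h3
  | cons a t => simp at h3; exact ⟨t, by rw [h3]⟩

theorem IsDiPath.cons {x y z : V} {l : List V} (h : IsDiPath D y z l) (hxy : D.Adj x y)
    (hx : x ∉ l) : IsDiPath D x z (x :: l) := by
  obtain ⟨t, rfl⟩ := h.exists_eq_cons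
  obtain ⟨h1, h2, -, h4⟩ := h
  refine ⟨List.nodup_cons.2 ⟨hx, h1⟩, List.isChain_cons_cons.2 ⟨hxy, h2⟩, rfl, ?_⟩
  rw [List.getLast?_cons_cons, h4]

/-- A directed path can be cut at any of its vertices; the final piece avoids the initial vertex
unless it is the whole path. -/
theorem IsDiPath.exists_suffix {x y p : V} {l : List V} (h : IsDiPath D x y l) (hp : p ∈ l) :
    ∃ l', IsDiPath D p y l' ∧ l' ⊆ l ∧ (p ≠ x → x ∉ l') := by
  obtain ⟨s, t, rfl⟩ := List.append_of_mem hp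
  obtain ⟨h1, h2, h3, h4⟩ := h
  refine ⟨p :: t, ⟨(List.nodup_append.1 h1).2.1, (List.isChain_append.1 h2).2.1, rfl, ?_⟩,
    List.subset_append_right _ _, ?_⟩
  · rw [← h4, List.getLast?_append]
    simp [List.getLast?_cons]
  · intro hpx hx
    cases s with
    | nil => simp at h3; exact hpx h3
    | cons a s =>
      simp at h3
      subst h3
      exact (List.nodup_append.1 h1).2.2 a (by simp) a hx rfl

theorem IsDiPath.append {x y z : V} {l m : List V} (hl : IsDiPath D x y l)
    (hm : IsDiPath D y z m) (hd : ∀ v ∈ l, v ∈ m → v = y) : IsDiPath D x z (l ++ m.tail) := by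
  obtain ⟨t, rfl⟩ := hm.exists_eq_cons
  obtain ⟨h1, h2, h3, h4⟩ := hl
  obtain ⟨g1, g2, -, g4⟩ := hm
  simp only [List.tail_cons]
  have hy : y ∉ t := (List.nodup_cons.1 g1).1
  refine ⟨List.nodup_append.2 ⟨h1, (List.nodup_cons.1 g1).2, ?_⟩,
    List.isChain_append.2 ⟨h2, (List.isChain_cons.1 g2).2, ?_⟩, ?_, ?_⟩
  · rintro a ha b hb rfl
    exact hy (hd a ha (by simp [hb]) ▸ hb)
  · intro a ha b hb
    rw [h4] at ha
    cases ha
    exact (List.isChain_cons.1 g2).1 b hb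
  · rw [List.head?_append, h3]; rfl
  · rw [List.getLast?_append, h4]
    rw [List.getLast?_cons] at g4
    cases ht : t.getLast? <;> simp_all

theorem IsDiPath.isDiCycle {x y : V} {l : List V} (h : IsDiPath D x y l) (hyx : D.Adj y x) :
    IsDiCycle D l := by
  obtain ⟨h1, h2, h3, h4⟩ := h
  have hne : l ≠ [] := by rintro rfl; simp at h3
  refine ⟨hne, h1, h2, ?_⟩
  rw [List.head?_eq_some_head hne, Option.some_inj] at h3
  rw [List.getLast?_eq_some_getLast hne, Option.some_inj] at h4
  rwa [h3, h4]

/-- A vertex that reaches a set `U` through vertices of `A` does so by a path that meets `U` only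
in its terminal vertex. -/
theorem exists_isDiPath_first_hit {A U : Set V} {x u : V} (hu : u ∈ U)
    (h : Relation.ReflTransGen (fun a b => D.Adj a b ∧ b ∈ A) x u) :
    ∃ p ∈ U, ∃ l, IsDiPath D x p l ∧ (∀ v ∈ l, v ∈ U → v = p) ∧ ∀ v ∈ l, v = x ∨ v ∈ A := by
  induction h using Relation.ReflTransGen.head_induction_on with
  | refl => exact ⟨u, hu, [u], .singleton u, by simp, by simp⟩
  | @head a b hab _ ih =>
    obtain ⟨p, hp, l, hl, h1, h2⟩ := ih
    have h3 : ∀ v ∈ l, v ∈ A := fun v hv => (h2 v hv).elim (fun e => e ▸ hab.2) id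
    by_cases haU : a ∈ U
    · exact ⟨a, haU, [a], .singleton a, by simp, by simp⟩
    by_cases hal : a ∈ l
    · obtain ⟨l', hl', hs, -⟩ := hl.exists_suffix hal
      exact ⟨p, hp, l', hl', fun v hv => h1 v (hs hv), fun v hv => .inr (h3 v (hs hv))⟩
    · refine ⟨p, hp, a :: l, hl.cons hab.1 hal, ?_, ?_⟩
      · intro v hv hvU
        rcases List.mem_cons.1 hv with rfl | hv
        · exact absurd hvU haU
        · exact h1 v hv hvU
      · intro v hv
        rcases List.mem_cons.1 hv with rfl | hv
        · exact .inl rfl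
        · exact .inr (h3 v hv)

/-! ### Fans and their extension along an arc -/

/-- Inside `Y`, there are a path from `x` to `a` and a path from `x` to `b` that share only `x`. -/
def HasFan (D : Digraph V) (Y : Set V) (x a b : V) : Prop :=
  ∃ P Q, IsDiPath D x a P ∧ IsDiPath D x b Q ∧ (∀ v ∈ P, v ∈ Y) ∧ (∀ v ∈ Q, v ∈ Y) ∧
    ∀ v ∈ P, v ∈ Q → v = x

theorem HasFan.symm {Y : Set V} {x a b : V} (h : HasFan D Y x a b) : HasFan D Y x b a := by
  obtain ⟨P, Q, hP, hQ, h1, h2, h3⟩ := h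
  exact ⟨Q, P, hQ, hP, h2, h1, fun v hv hv' => h3 v hv' hv⟩

/-- A fan at `y` is turned into a fan at an in-neighbour `x` of `y` with the help of a path `S`
from `x` to a vertex of `P` that avoids `y`. -/
theorem hasFan_of_adj {Y : Set V} {x y a b p : V} {P Q S : List V} (hxy : D.Adj x y) (hx : x ∈ Y)
    (hP : IsDiPath D y a P) (hQ : IsDiPath D y b Q) (hPY : ∀ v ∈ P, v ∈ Y)
    (hQY : ∀ v ∈ Q, v ∈ Y) (hPQ : ∀ v ∈ P, v ∈ Q → v = y) (hxQ : x ∉ Q) (hS : IsDiPath D x p S)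
    (hp : p ∈ P) (hSY : ∀ v ∈ S, v ∈ Y) (hyS : y ∉ S) (hSPQ : ∀ v ∈ S, v ∈ P ∨ v ∈ Q → v = p) :
    HasFan D Y x a b := by
  have hpy : p ≠ y := fun e => hyS (e ▸ hS.end_mem)
  obtain ⟨P', hP', hs, hy⟩ := hP.exists_suffix hp
  refine ⟨S ++ P'.tail, x :: Q, hS.append hP' fun v hv hv' => hSPQ v hv (.inl (hs hv')),
    hQ.cons hxy hxQ, ?_, ?_, ?_⟩
  · intro v hv
    rcases List.mem_append.1 hv with hv | hv
    · exact hSY v hv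
    · exact hPY v (hs (List.mem_of_mem_tail hv))
  · intro v hv
    rcases List.mem_cons.1 hv with rfl | hv
    · exact hx
    · exact hQY v hv
  · intro v hv hv'
    rcases List.mem_cons.1 hv' with rfl | hv'
    · rfl
    rcases List.mem_append.1 hv with hv | hv
    · have e := hSPQ v hv (.inr hv')
      exact absurd (hPQ v (e ▸ hp) hv') (e ▸ hpy)
    · have hv := List.mem_of_mem_tail hv
      exact absurd (hPQ v (hs hv) hv' ▸ hv) (hy hpy)

/-- One branch is prolonged backwards by the arc xy; the other is reached by a path from x that
avoids y and stops on first meeting the fan. The branch it meets is the one rerouted. -/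
theorem HasFan.of_adj {Y : Set V} {x y a b : V} (h : HasFan D Y y a b) (hxy : D.Adj x y)
    (hne : x ≠ y) (hx : x ∈ Y)
    (hr : Relation.ReflTransGen (fun u v => D.Adj u v ∧ v ∈ Y \ {y}) x b) :
    HasFan D Y x a b := by
  obtain ⟨P, Q, hP, hQ, hPY, hQY, hPQ⟩ := h
  obtain ⟨p, hp, S, hS, hS1, hS2⟩ :=
    exists_isDiPath_first_hit (U := {v | v ∈ P ∨ v ∈ Q}) (.inr hQ.end_mem) hr
  have hSY : ∀ v ∈ S, v ∈ Y := fun v hv => (hS2 v hv).elim (fun e => e ▸ hx) fun h => h.1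
  have hyS : y ∉ S := fun hv => (hS2 y hv).elim (fun e => hne e.symm) fun h => h.2 rfl
  rcases hp with hp | hp
  · by_cases hxQ : x ∈ Q
    -- If x already lies on Q, the arc cannot prolong Q: keep the part of Q after x and prolong P
    -- instead.
    · have hxP : x ∉ P := fun hxP => hne (hPQ x hxP hxQ)
      exact (hasFan_of_adj hxy hx hQ hP hQY hPY (fun v hv hv' => hPQ v hv' hv) hxP
        (.singleton x) hxQ (by simpa using hx) (by simpa using hne.symm) (by simp)).symm
    · exact hasFan_of_adj hxy hx hP hQ hPY hQY hPQ hxQ hS hp hSY hyS hS1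
  · by_cases hxP : x ∈ P
    · have hxQ : x ∉ Q := fun hxQ => hne (hPQ x hxP hxQ)
      exact hasFan_of_adj hxy hx hP hQ hPY hQY hPQ hxQ (.singleton x) hxP (by simpa using hx)
        (by simpa using hne.symm) (by simp)
    · exact (hasFan_of_adj hxy hx hQ hP hQY hPY (fun v hv hv' => hPQ v hv' hv) hxP hS hp hSY hyS
        fun v hv h => hS1 v hv h.symm).symm

/-! ### Finding the arc and the two paths -/

/-- A finite non-empty loopless digraph of minimum out-degree at least `2` has an arc from `y` to
`x` and two directed paths from `x` to `y` that are internally disjoint. -/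
theorem exists_adj_and_internally_disjoint_paths [Finite V] [Nonempty V]
    (hloop : ∀ v, ¬ D.Adj v v) (hdeg : ∀ v z, ∃ w, D.Adj v w ∧ w ≠ z) :
    ∃ x y P Q, D.Adj y x ∧ IsDiPath D x y P ∧ IsDiPath D x y Q ∧
      ∀ v ∈ P, v ∈ Q → v = x ∨ v = y := by
  obtain ⟨T, ⟨⟨t, ht⟩, hTcl⟩, hTmin⟩ :=
    WellFounded.has_min (α := Set V) (r := (· < ·)) wellFounded_lt
    {T | T.Nonempty ∧ ∀ u ∈ T, ∀ v, D.Adj u v → v ∈ T}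
    ⟨Set.univ, Set.univ_nonempty, fun _ _ _ _ => trivial⟩
  have hTreach : ∀ a ∈ T, ∀ b ∈ T, Relation.ReflTransGen D.Adj a b := by
    intro a ha b hb
    by_contra hab
    refine hTmin {c | c ∈ T ∧ Relation.ReflTransGen D.Adj a c}
      ⟨⟨a, ha, .refl⟩, fun u hu v huv => ⟨hTcl u hu.1 v huv, hu.2.tail huv⟩⟩ ?_
    exact (Set.ssubset_iff_of_subset fun _ h => h.1).2 ⟨b, hb, fun h => hab h.2⟩
  obtain ⟨X, ⟨⟨x₀, hx₀⟩, hXT, z, hzT, hzX, hXcl⟩, hXmin⟩ :=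
    WellFounded.has_min (α := Set V) (r := (· < ·)) wellFounded_lt
    {X | X.Nonempty ∧ X ⊆ T ∧ ∃ z ∈ T, z ∉ X ∧ ∀ u ∈ X, ∀ v, D.Adj u v → v ∈ X ∨ v = z}
    (by
      obtain ⟨w, hw, hwt⟩ := hdeg t t
      refine ⟨T \ {t}, ⟨w, hTcl t ht w hw, hwt⟩, Set.sdiff_subset, t, ht, by simp, ?_⟩
      intro u hu v huv
      by_cases hv : v = t
      · exact .inr hv
      · exact .inl ⟨hTcl u hu.1 v huv, hv⟩)
  have hXreach : ∀ a ∈ X, ∀ b ∈ X,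
      Relation.ReflTransGen (fun u v => D.Adj u v ∧ v ∈ X) a b := by
    intro a ha b hb
    by_contra hab
    refine hXmin {c | c ∈ X ∧ Relation.ReflTransGen (fun u v => D.Adj u v ∧ v ∈ X) a c}
      ⟨⟨a, ha, .refl⟩, fun u hu => hXT hu.1, z, hzT, fun h => hzX h.1, ?_⟩ ?_
    · intro u hu v huv
      rcases hXcl u hu.1 v huv with h | h
      · exact .inl ⟨h, hu.2.tail ⟨huv, h⟩⟩
      · exact .inr h
    · exact (Set.ssubset_iff_of_subset fun _ h => h.1).2 ⟨b, hb, fun h => hab h.2⟩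
  -- The vertices of X other than w that cannot reach z without w send arcs only to each other and
  -- to w. If there were any, they would be a smaller candidate than X, with w in the role of z.
  have hexit : ∀ a ∈ X, ∀ w ∈ X, a ≠ w →
      Relation.ReflTransGen (fun u v => D.Adj u v ∧ v ∈ insert z X \ {w}) a z := by
    intro a ha w hw haw
    have hzw : z ≠ w := fun e => hzX (e ▸ hw)
    by_contra hna
    refine hXmin {c | c ∈ X ∧ c ≠ w ∧
        ¬ Relation.ReflTransGen (fun u v => D.Adj u v ∧ v ∈ insert z X \ {w}) c z}
      ⟨⟨a, ha, haw, hna⟩, fun u hu => hXT hu.1, w, hXT hw, fun h => h.2.1 rfl, ?_⟩ ?_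
    · intro u hu v huv
      by_cases hvw : v = w
      · exact .inr hvw
      refine .inl ?_
      have hv : v ∈ insert z X := (hXcl u hu.1 v huv).symm
      have hvr : ¬ Relation.ReflTransGen (fun u v => D.Adj u v ∧ v ∈ insert z X \ {w}) v z :=
        fun h => hu.2.2 (.head ⟨huv, hv, hvw⟩ h)
      refine ⟨hv.resolve_left ?_, hvw, hvr⟩
      rintro rfl
      exact hvr .refl
    · exact (Set.ssubset_iff_of_subset fun _ h => h.1).2 ⟨w, hw, fun h => h.2.1 rfl⟩
  obtain ⟨r, hr, R, hR, hRX, -⟩ := exists_isDiPath_first_hit (D := D) (A := Set.univ) (U := X) hx₀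
    (Relation.ReflTransGen.mono (fun _ _ h => ⟨h, trivial⟩) _ _ (hTreach z hzT x₀ (hXT hx₀)))
  -- Out-degree 2 is needed here, since z may itself be an out-neighbour of r.
  obtain ⟨x, hrx, hxz⟩ := hdeg r z
  have hx : x ∈ X := (hXcl r hr x hrx).resolve_right hxz
  have hxr : x ≠ r := fun e => hloop r (e ▸ hrx)
  have hbase : HasFan D (insert z X) r r z := by
    have h : Relation.ReflTransGen (fun u v => D.Adj u v ∧ v ∈ insert z X) r z :=
      .head ⟨hrx, .inr hx⟩ (Relation.ReflTransGen.mono (fun _ _ h => ⟨h.1, h.2.1⟩) _ _ (hexit x hx r hr hxr))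
    obtain ⟨p, rfl, Q, hQ, -, hQ'⟩ := exists_isDiPath_first_hit (U := {z}) rfl h
    exact ⟨[r], Q, .singleton r, hQ, by simp [hr],
      fun v hv => (hQ' v hv).elim (fun e => .inr (e ▸ hr)) id, by simp +contextual⟩
  have hfan : x ∈ X → HasFan D (insert z X) x r z := by
    refine (hXreach x hx r hr).head_induction_on (motive := fun a _ => a ∈ X →
      HasFan D (insert z X) a r z) (fun _ => hbase) ?_
    intro a c hac _ ih ha
    have hne : a ≠ c := fun e => hloop c (e ▸ hac.1)
    exact (ih hac.2).of_adj hac.1 hne (.inr ha) (hexit a ha c hac.2 hne)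
  obtain ⟨P, Q, hP, hQ, hPY, hQY, hPQ⟩ := hfan hx
  have hrQ : r ∉ Q := fun h => hxr (hPQ r hP.end_mem h).symm
  have hzP : z ∉ P := fun h => hxz (hPQ z h hQ.end_mem).symm
  refine ⟨x, r, P, Q ++ R.tail, hrx, hP, hQ.append hR fun v hv hv' => ?_, fun v hv hv' => ?_⟩
  · rcases hQY v hv with h | h
    · exact h
    · exact absurd (hRX v hv' h ▸ hv) hrQ
  · rcases List.mem_append.1 hv' with hv' | hv'
    · exact .inl (hPQ v hv hv')
    · rcases hPY v hv with rfl | h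
      · exact absurd hv hzP
      · exact .inr (hRX v (List.mem_of_mem_tail hv') h)

end Paths


/-! ### From two long paths to a subdivision of C(k,k) -/

section Subdivision

variable {V : Type*} {D : Digraph V}

/-- A long directed path is cut into `k` consecutive pieces, all but the last of which are single
arcs. -/
theorem IsDiPath.exists_pieces {x y : V} {L : List V} (h : IsDiPath D x y L) {k : ℕ} (hk : 1 ≤ k)
    (hL : k + 2 ≤ L.length) :
    ∃ (node : ℕ → V) (piece : ℕ → List V), node 0 = x ∧ node k = y ∧ (∀ i, node i ∈ L) ∧
      (∀ i ≤ k, ∀ j ≤ k, node i = node j → i = j) ∧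
      (∀ i < k, IsDiPath D (node i) (node (i + 1)) (piece i)) ∧
      (∀ i < k, piece i ⊆ L) ∧ (∀ i < k, ∃ v ∈ piece i, v ≠ x ∧ v ≠ y) ∧
      (∀ i < k, ∀ v ∈ pathInterior (piece i), i + 1 = k ∧ v ∈ L ∧ ∀ j ≤ k, v ≠ node j) := by
  obtain ⟨h1, h2, h3, h4⟩ := h
  have hx : L[0] = x := by
    rw [List.head?_eq_getElem?, List.getElem?_eq_getElem (by omega)] at h3
    simpa using h3
  have hy : L[L.length - 1] = y := by
    rw [List.getLast?_eq_getElem?, List.getElem?_eq_getElem (by omega)] at h4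
    simpa using h4
  have hinj : ∀ i j (hi : i < L.length) (hj : j < L.length), L[i] = L[j] → i = j :=
    fun i j hi hj e => (h1.getElem_inj_iff).1 e
  let node : ℕ → V := fun i => if h : i < k then L[i] else y
  have hn : ∀ i (hi : i < k), node i = L[i] := fun i hi => by simp [node, hi]
  have hnk : node k = y := by simp [node]
  have hdrop : ∀ v ∈ pathInterior (L.drop (k - 1)),
      ∃ m, ∃ hm : m + 1 < L.length, k ≤ m ∧ v = L[m] := by
    intro v hv
    rw [pathInterior, List.tail_drop] at hv
    obtain ⟨i, hi, rfl⟩ := List.getElem_of_mem hv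
    simp only [List.length_dropLast, List.length_drop] at hi
    refine ⟨k + i, by omega, by omega, ?_⟩
    simp only [List.getElem_dropLast, List.getElem_drop]
    congr 1
    omega
  refine ⟨node, fun i => if i + 1 < k then [node i, node (i + 1)] else L.drop (k - 1), ?_, hnk,
    ?_, ?_, ?_, ?_, ?_, ?_⟩
  · rw [hn 0 hk, hx]
  · intro i
    by_cases hi : i < k
    · rw [hn i hi]; exact List.getElem_mem _
    · simp only [node, hi, dite_false]
      rw [← hy]; exact List.getElem_mem _
  · intro i hi j hj e
    rcases hi.lt_or_eq with hi | rfl <;> rcases hj.lt_or_eq with hj | rfl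
    · rw [hn i hi, hn j hj] at e
      exact hinj _ _ _ _ e
    · rw [hn i hi, hnk, ← hy] at e
      have := hinj _ _ _ _ e
      omega
    · rw [hn j hj, hnk, ← hy] at e
      have := hinj _ _ _ _ e
      omega
    · rfl
  · intro i hi
    by_cases hik : i + 1 < k
    · simp only [hik, if_true]
      rw [hn i hi, hn _ hik]
      refine IsDiPath.cons (.singleton _) ?_ ?_
      · exact List.isChain_iff_getElem.1 h2 i (by omega)
      · intro hm
        have := hinj _ _ _ _ (List.mem_singleton.1 hm)
        omega
    · obtain rfl : i + 1 = k := by omega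
      simp only [lt_irrefl, if_false, Nat.add_sub_cancel]
      rw [hn i hi, hnk]
      refine ⟨h1.sublist (List.drop_sublist _ _), h2.drop _, ?_, ?_⟩
      · rw [List.head?_drop, List.getElem?_eq_getElem]
      · rw [List.getLast?_drop, if_neg (by omega), h4]
  · intro i hi v hv
    by_cases hik : i + 1 < k
    · simp only [hik, if_true, List.mem_cons, List.not_mem_nil, or_false] at hv
      rcases hv with rfl | rfl
      · rw [hn i hi]; exact List.getElem_mem _
      · rw [hn _ hik]; exact List.getElem_mem _
    · simp only [hik, if_false] at hv
      exact List.mem_of_mem_drop hv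
  · intro i hi
    -- Since i + 1 ≤ k and L has at least k + 2 vertices, this vertex is internal to L. It later
    -- tells pieces of P from pieces of Q.
    have hne : L[i + 1] ≠ x ∧ L[i + 1] ≠ y := by
      constructor
      · intro e
        rw [← hx] at e
        have := hinj _ _ _ _ e
        omega
      · intro e
        rw [← hy] at e
        have := hinj _ _ _ _ e
        omega
    refine ⟨L[i + 1], ?_, hne⟩
    by_cases hik : i + 1 < k
    · simp [hik, hn _ hik]
    · obtain rfl : i + 1 = k := by omega
      simp only [lt_irrefl, if_false, Nat.add_sub_cancel]
      exact List.mem_iff_getElem.2 ⟨1, by simp; omega, by simp⟩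
  · intro i hi v hv
    by_cases hik : i + 1 < k
    · simp [hik, pathInterior] at hv
    · simp only [hik, if_false] at hv
      obtain ⟨m, hm, hkm, rfl⟩ := hdrop v hv
      refine ⟨by omega, List.getElem_mem _, fun j hj e => ?_⟩
      rcases hj.lt_or_eq with hj | rfl
      · rw [hn j hj] at e
        have := hinj _ _ _ _ e
        omega
      · rw [hnk, ← hy] at e
        have := hinj _ _ _ _ e
        omega

/-- Two internally disjoint directed paths of length more than `k` with the same ends form a
subdivision of `C(k, k)`. -/
theorem containsSubdivision_twoBlockCycle {x y : V} {P Q : List V} (hP : IsDiPath D x y P)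
    (hQ : IsDiPath D x y Q) (hPQ : ∀ v ∈ P, v ∈ Q → v = x ∨ v = y) {k : ℕ} (hk : 1 ≤ k)
    (hPk : k + 2 ≤ P.length) (hQk : k + 2 ≤ Q.length) :
    ContainsSubdivision (twoBlockCycle k k hk hk) D := by
  obtain ⟨f, p, f0, fk, fm, fi, pp, ps, pv, pint⟩ := hP.exists_pieces hk hPk
  obtain ⟨g, q, g0, gk, gm, gi, qp, qs, qv, qint⟩ := hQ.exists_pieces hk hQk
  have hfg : ∀ i ≤ k, ∀ j ≤ k, f i = g j → (i = 0 ∧ j = 0) ∨ (i = k ∧ j = k) := by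
    intro i hi j hj e
    rcases hPQ _ (fm i) (e ▸ gm j) with h | h
    · exact .inl ⟨fi i hi 0 (by omega) (h.trans f0.symm),
        gi j hj 0 (by omega) ((e.symm.trans h).trans g0.symm)⟩
    · exact .inr ⟨fi i hi k le_rfl (h.trans fk.symm),
        gi j hj k le_rfl ((e.symm.trans h).trans gk.symm)⟩
  -- The pattern numbers its second path backwards, so vertex i ≥ k sits at position 2k - i on Q and
  -- arc i ≥ k is piece 2k - 1 - i.
  let φ : Fin (k + k) → V := fun i => if i.val ≤ k then f i else g (k + k - i)
  have hφg : ∀ i : Fin (k + k), k ≤ i.val → φ i = g (k + k - i) := by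
    intro i hi
    rcases hi.lt_or_eq with hi | hi
    · simp [φ, Nat.not_le.2 hi]
    · simp only [φ, ← hi, le_refl, if_true, Nat.add_sub_cancel, fk, gk]
  have hφf : ∀ i : Fin (k + k), i.val ≤ k → φ i = f i := fun i hi => by simp [φ, hi]
  have hφ : ∀ i, ∃ j ≤ k, φ i = f j ∨ φ i = g j := by
    intro i
    rcases le_total i.val k with hi | hi
    · exact ⟨i, hi, .inl (hφf i hi)⟩
    · exact ⟨k + k - i, by omega, .inr (hφg i hi)⟩
  refine ⟨φ, fun i => if i.val < k then p i else q (k + k - 1 - i), ?_, ?_, ?_, ?_, ?_⟩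
  · intro i j e
    have hi := i.isLt
    have hj := j.isLt
    refine Fin.ext ?_
    rcases le_or_gt i.val k with hik | hik <;> rcases le_or_gt j.val k with hjk | hjk
    · rw [hφf i hik, hφf j hjk] at e
      exact fi _ hik _ hjk e
    · rw [hφf i hik, hφg j hjk.le] at e
      have := hfg _ hik _ (by omega) e
      omega
    · rw [hφg i hik.le, hφf j hjk] at e
      have := hfg _ hjk _ (by omega) e.symm
      omega
    · rw [hφg i hik.le, hφg j hjk.le] at e
      have := gi _ (by omega) _ (by omega) e
      omega
  · have hpq : ∀ i < k, ∀ j < k, p i ≠ q j := by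
      intro i hi j hj e
      obtain ⟨v, hv, hvx, hvy⟩ := pv i hi
      exact (hPQ v (ps i hi hv) (qs j hj (e ▸ hv))).elim hvx hvy
    have hpp : ∀ i < k, ∀ j < k, p i = p j → i = j := by
      intro i hi j hj e
      have h := (pp i hi).2.2.1
      rw [e, (pp j hj).2.2.1, Option.some_inj] at h
      exact fi i hi.le j hj.le h.symm
    have hqq : ∀ i < k, ∀ j < k, q i = q j → i = j := by
      intro i hi j hj e
      have h := (qp i hi).2.2.1
      rw [e, (qp j hj).2.2.1, Option.some_inj] at h
      exact gi i hi.le j hj.le h.symm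
    intro i j e
    have hi := i.isLt
    have hj := j.isLt
    refine Fin.ext ?_
    rcases lt_or_ge i.val k with hik | hik <;> rcases lt_or_ge j.val k with hjk | hjk
    · simp only [hik, hjk, if_true] at e
      exact hpp _ hik _ hjk e
    · simp only [hik, hjk.not_gt, if_true, if_false] at e
      exact absurd e (hpq _ hik _ (by omega))
    · simp only [hik.not_gt, hjk, if_true, if_false] at e
      exact absurd e.symm (hpq _ hjk _ (by omega))
    · simp only [hik.not_gt, hjk.not_gt, if_false] at e
      have := hqq _ (by omega) _ (by omega) e
      omega
  · intro i
    have hi := i.isLt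
    by_cases hik : i.val < k
    · have hs : (cyclicSucc i).val = i.val + 1 := Nat.mod_eq_of_lt (by omega)
      simp only [twoBlockCycle, hik, if_true]
      rw [hφf i hik.le, hφf _ (by omega), hs]
      exact pp _ hik
    · simp only [twoBlockCycle, hik, if_false]
      have hh : φ i = g (k + k - 1 - i + 1) := by
        rw [hφg i (by omega)]
        congr 1
        omega
      have ht : φ (cyclicSucc i) = g (k + k - 1 - i) := by
        rcases Nat.lt_or_ge (i.val + 1) (k + k) with h | h
        · have hs : (cyclicSucc i).val = i.val + 1 := Nat.mod_eq_of_lt h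
          rw [hφg _ (by omega), hs]
          congr 1
          omega
        · have hs : (cyclicSucc i).val = 0 := by
            have : i.val + 1 = k + k := by omega
            simp [cyclicSucc, this]
          rw [hφf _ (by omega), hs, f0, ← g0]
          congr 1
          omega
      rw [hh, ht]
      exact qp _ (by omega)
  · rintro i v hv ⟨j, rfl⟩
    have hi := i.isLt
    obtain ⟨m, hm, hj⟩ := hφ j
    by_cases hik : i.val < k
    · simp only [hik, if_true] at hv
      obtain ⟨-, hvP, hvn⟩ := pint _ hik _ hv
      rcases hj with hj | hj
      · exact hvn m hm hj
      · rcases hPQ _ hvP (hj ▸ gm m) with h | h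
        · exact hvn 0 (by omega) (h.trans f0.symm)
        · exact hvn k le_rfl (h.trans fk.symm)
    · simp only [hik, if_false] at hv
      obtain ⟨-, hvQ, hvn⟩ := qint _ (by omega) _ hv
      rcases hj with hj | hj
      · rcases hPQ _ (hj ▸ fm m) hvQ with h | h
        · exact hvn 0 (by omega) (h.trans g0.symm)
        · exact hvn k le_rfl (h.trans gk.symm)
      · exact hvn m hm hj
  · have hpq : ∀ i < k, ∀ j < k, ∀ v ∈ pathInterior (p i), v ∉ pathInterior (q j) := by
      intro i hi j hj v hv hv'
      obtain ⟨-, hvP, hvn⟩ := pint i hi v hv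
      obtain ⟨-, hvQ, -⟩ := qint j hj v hv'
      rcases hPQ v hvP hvQ with h | h
      · exact hvn 0 (by omega) (h.trans f0.symm)
      · exact hvn k le_rfl (h.trans fk.symm)
    intro i j hij v hv hv'
    have hi := i.isLt
    have hj := j.isLt
    have hij : i.val ≠ j.val := fun e => hij (Fin.ext e)
    rcases lt_or_ge i.val k with hik | hik <;> rcases lt_or_ge j.val k with hjk | hjk
    -- Only the last piece of a path has internal vertices, so two distinct pieces cannot both have
    -- some.
    · simp only [hik, hjk, if_true] at hv hv'
      have h1 := (pint _ hik _ hv).1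
      have h2 := (pint _ hjk _ hv').1
      omega
    · simp only [hik, hjk.not_gt, if_true, if_false] at hv hv'
      exact hpq _ hik _ (by omega) v hv hv'
    · simp only [hik.not_gt, hjk, if_true, if_false] at hv hv'
      exact hpq _ hjk _ (by omega) v hv' hv
    · simp only [hik.not_gt, hjk.not_gt, if_false] at hv hv'
      have h1 := (qint _ (by omega) _ hv).1
      have h2 := (qint _ (by omega) _ hv').1
      omega

end Subdivision

/-! ### Degree and girth: the two bounds -/

section Degree

variable {V : Type*} {D : Digraph V}

theorem le_length_of_le_digirth {g : ℕ} (h : (g : ℕ∞) ≤ digirth D) {c : List V}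
    (hc : IsDiCycle D c) : g ≤ c.length := by
  have h1 : digirth D ≤ c.length := iInf₂_le c hc
  exact_mod_cast h.trans h1

theorem exists_adj_ne_of_two_le_minOutDegree (h : (2 : ℕ∞) ≤ minOutDegree D) (v z : V) :
    ∃ w, D.Adj v w ∧ w ≠ z := by
  have h1 : 1 < Set.encard {w : V | D.Adj v w} :=
    lt_of_lt_of_le (by norm_num) (h.trans (iInf_le _ v))
  obtain ⟨a, b, ha, hb, hab⟩ := Set.one_lt_encard_iff.1 h1
  by_cases haz : a = z
  · exact ⟨b, hb, fun e => hab (haz.trans e.symm)⟩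
  · exact ⟨a, ha, haz⟩

theorem containsSubdivision_of_two_le_minOutDegree [Finite V] [Nonempty V] {k g : ℕ} (hk : 1 ≤ k)
    (hg : k + 2 ≤ g) (hD : (2 : ℕ∞) ≤ minOutDegree D) (hgD : (g : ℕ∞) ≤ digirth D) :
    ContainsSubdivision (twoBlockCycle k k hk hk) D := by
  have hloop : ∀ v, ¬ D.Adj v v := fun v hv => by
    have := le_length_of_le_digirth hgD (IsDiPath.isDiCycle (.singleton v) hv)
    simp at this
    omega
  obtain ⟨x, y, P, Q, hyx, hP, hQ, hPQ⟩ := exists_adj_and_internally_disjoint_paths hloop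
    (exists_adj_ne_of_two_le_minOutDegree hD)
  exact containsSubdivision_twoBlockCycle hP hQ hPQ hk
    (hg.trans (le_length_of_le_digirth hgD (hP.isDiCycle hyx)))
    (hg.trans (le_length_of_le_digirth hgD (hQ.isDiCycle hyx)))

/-- In a digraph of maximum out-degree at most `1` no vertex is the source of a two-block cycle. -/
theorem not_containsSubdivision_of_unique_adj (h : ∀ u v w, D.Adj u v → D.Adj u w → v = w)
    {k : ℕ} (hk : 1 ≤ k) : ¬ ContainsSubdivision (twoBlockCycle k k hk hk) D := by
  rintro ⟨φ, P, hφ, hPinj, hP, hint, hdisj⟩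
  have hstep : ∀ {x y : V} {l : List V}, IsDiPath D x y l → x ≠ y →
      ∃ v t, l = x :: v :: t ∧ D.Adj x v ∧ (v ∈ pathInterior l ∨ v = y ∧ t = []) := by
    intro x y l hl hxy
    obtain ⟨s, rfl⟩ := hl.exists_eq_cons
    obtain ⟨-, h2, -, h4⟩ := hl
    cases s with
    | nil => simp at h4; exact absurd h4 hxy
    | cons v t =>
      refine ⟨v, t, rfl, (List.isChain_cons_cons.1 h2).1, ?_⟩
      cases t with
      | nil => simp at h4; exact .inr ⟨h4, rfl⟩
      | cons w t => exact .inl (by simp [pathInterior])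
  -- The two arcs of the pattern that leave its source 0. Their paths must share their second
  -- vertex.
  let a : Fin (k + k) := ⟨0, by omega⟩
  let b : Fin (k + k) := ⟨k + k - 1, by omega⟩
  have hab : a ≠ b := fun e => by
    have := congrArg Fin.val e
    simp only [a, b] at this
    omega
  have hta : (twoBlockCycle k k hk hk).tail a = a := if_pos hk
  have htb : (twoBlockCycle k k hk hk).tail b = a := by
    refine (if_neg (by simp only [b]; omega)).trans (Fin.ext ?_)
    simp [cyclicSucc, a, b, show k + k - 1 + 1 = k + k by omega]
  have hne : ∀ c, φ ((twoBlockCycle k k hk hk).tail c) ≠ φ ((twoBlockCycle k k hk hk).head c) :=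
    fun c e => (twoBlockCycle k k hk hk).loopless c (hφ e)
  obtain ⟨v, s, hs, hv, hv'⟩ := hstep (hP a) (hne a)
  obtain ⟨w, t, ht, hw, hw'⟩ := hstep (hP b) (hne b)
  rw [hta] at hs hv
  rw [htb] at ht hw
  obtain rfl := h _ _ _ hv hw
  rcases hv' with hv' | ⟨hv', rfl⟩ <;> rcases hw' with hw' | ⟨hw', rfl⟩
  · exact hdisj a b hab hv' hw'
  · exact hint a v hv' (hw' ▸ Set.mem_range_self _)
  · exact hint b v hw' (hv' ▸ Set.mem_range_self _)
  · exact hab (hPinj (hs.trans ht.symm))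

/-- The directed cycle of length `n`. -/
def directedCycle (n : ℕ) : Digraph (ULift.{u} (ZMod n)) where
  Adj a b := b.down = a.down + 1

/-- Each arc adds 1 to the residue, so going once round a directed cycle shows that n divides its
length. -/
theorem le_digirth_directedCycle (n : ℕ) : (n : ℕ∞) ≤ digirth (directedCycle.{u} n) := by
  refine le_iInf₂ fun l hl => ?_
  obtain ⟨hne, -, hchain, hlast⟩ := hl
  have hpos := List.length_pos_iff.2 hne
  have hidx : ∀ i (hi : i < l.length), l[i].down = l[0].down + (i : ZMod n) := by
    intro i
    induction i with
    | zero => simp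
    | succ i ih =>
      intro hi
      have h1 : l[i + 1].down = l[i].down + 1 := List.isChain_iff_getElem.1 hchain i hi
      rw [h1, ih (by omega)]
      push_cast
      ring
  have h1 : (l.head hne).down = (l.getLast hne).down + 1 := hlast
  rw [List.getLast_eq_getElem, List.head_eq_getElem, hidx (l.length - 1) (by omega), add_assoc] at h1
  have h2 : ((l.length : ℕ) : ZMod n) = 0 := by
    have h3 := left_eq_add.1 h1
    rw [← Nat.cast_add_one, Nat.sub_add_cancel hpos] at h3
    exact h3
  exact_mod_cast Nat.le_of_dvd hpos ((ZMod.natCast_eq_zero_iff _ _).1 h2)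

theorem one_le_minOutDegree_directedCycle (n : ℕ) :
    (1 : ℕ∞) ≤ minOutDegree (directedCycle.{u} n) := by
  refine le_iInf fun v => Set.one_le_encard_iff_nonempty.2 ⟨⟨v.down + 1⟩, ?_⟩
  rfl

end Degree

theorem theorem1p4 (k : ℕ) (hk : 1 ≤ k) :
    IsGirthMaderNumber.{u} (4 * k + 2) (twoBlockCycle k k hk hk) 2 := by
  constructor
  · intro W _ _ D hD hg
    exact containsSubdivision_of_two_le_minOutDegree hk (by omega) hD hg
  · intro d hd
    by_contra! hlt
    have hd1 : (d : ℕ∞) ≤ 1 := by exact_mod_cast Nat.le_of_lt_succ hlt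
    -- Makes `ZMod (4 * k + 2)` finite, as `hd` requires.
    have : NeZero (4 * k + 2) := ⟨by omega⟩
    refine not_containsSubdivision_of_unique_adj (D := directedCycle.{u} (4 * k + 2)) ?_ hk
      (hd _ _ (hd1.trans (one_le_minOutDegree_directedCycle _)) (le_digirth_directedCycle _))
    intro a b c hb hc
    exact ULift.down_injective (Eq.trans hb (Eq.symm hc))
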